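/- For positive integers $n$ and $d$, let $A_2(n,d)$ denote the maximum number of codewords in a binary code $C\subseteq\mathbb{F}_2^n$ of length $n$ and minimum distance $d$ (that is, any two distinct codewords of $C$ are at Hamming distance at least $d$), and let $V(n,r)=\sum_{i=0}^{r}\binom{n}{i}$ denote the volume of a Hamming sphere of radius $r$ in $\mathbb{F}_2^n$. Then there exists an absolute constant $c>0$ such that for all positive integers $n$ and $d$ with $d/n\le 0.499$, $$A_2(n,d)\ \ge\ c\,\frac{2^n}{V(n,d-1)}\,\log_2 V(n,d-1).$$ -/

import Mathlib

namespace BinaryCode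

/-- A binary code `C ⊆ 𝔽₂ⁿ` has minimum distance (at least) `d`: any two distinct codewords
are at Hamming distance at least `d`. -/
def HasMinDist {n : ℕ} (d : ℕ) (C : Finset (Fin n → ZMod 2)) : Prop :=
  ∀ x ∈ C, ∀ y ∈ C, x ≠ y → d ≤ hammingDist x y

/-- `A₂(n,d)`: the maximum number of codewords of a binary code of length `n` and
minimum distance `d`. -/
noncomputable def A₂ (n d : ℕ) : ℕ :=
  sSup {m : ℕ | ∃ C : Finset (Fin n → ZMod 2), HasMinDist d C ∧ C.card = m}

/-- `V(n,r) = ∑_{i=0}^{r} (n choose i)`: the volume of a Hamming sphere of radius `r` in `𝔽₂ⁿ`. -/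
def V (n r : ℕ) : ℕ := ∑ i ∈ Finset.range (r + 1), n.choose i

/-- The supremum defining `A₂(n,d)` is an attained maximum. -/
theorem isGreatest_A₂ (n d : ℕ) :
    IsGreatest {m : ℕ | ∃ C : Finset (Fin n → ZMod 2), HasMinDist d C ∧ C.card = m} (A₂ n d) := by
  have hb : BddAbove {m : ℕ | ∃ C : Finset (Fin n → ZMod 2), HasMinDist d C ∧ C.card = m} := by
    refine ⟨Fintype.card (Fin n → ZMod 2), ?_⟩
    rintro m ⟨C, -, rfl⟩
    exact Finset.card_le_univ C
  have hn : {m : ℕ | ∃ C : Finset (Fin n → ZMod 2), HasMinDist d C ∧ C.card = m}.Nonempty :=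
    ⟨0, ∅, by simp [HasMinDist], rfl⟩
  exact ⟨Nat.sSup_mem hn hb, fun m hm => le_csSup hb hm⟩

end BinaryCode

/-!
Join two words at distance less than `d`: codes become the independent sets of a graph of degree
`D < V n (d - 1)` (Jiang and Vardy). Let `T` bound the number of adjacent pairs in a neighbourhood.
In the hard-core model at fugacity `1 / √T` a neighbourhood behaves like a set without edges, and a
random independent set either contains `v` or meets the neighbourhood of `v` often; averaging over
`v` yields an independent set larger than the greedy bound by a factor of order `log (D / √T)`.

For codes `T` counts the triangles of diameter less than `d` with a vertex at the origin.
Evaluating generating functions at the odds `p / (1 - p)`, where `p = (d - 1) / n`, bounds both `V`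
and `T` from above. Together with Stirling's formula this shows that `T ≤ C * V ^ (2 - ε)` when
`d / n` stays away from `1 / 2`, so `log (V / √T)` is of order `log V`. The bounded loss `log C` is
paid for by the Gilbert–Varshamov bound.
-/

namespace HardCore

open Finset

/-- The Fenchel–Young inequality for `exp`, whose convex conjugate is `x * (log x - 1)`. -/
theorem mul_le_exp_add_mul_log_sub_one {x : ℝ} (hx : 0 < x) (a : ℝ) :
    a * x ≤ Real.exp a + x * (Real.log x - 1) := by
  have hexp : Real.exp a = x * Real.exp (a - Real.log x) := by
    rw [Real.exp_sub, Real.exp_log hx]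
    field_simp
  have := mul_le_mul_of_nonneg_left (Real.add_one_le_exp (a - Real.log x)) hx.le
  linarith

theorem sum_card_filter_adj {α : Type*} (G : SimpleGraph α) [DecidableRel G.Adj]
    (X Y : Finset α) : ∑ u ∈ X, #{w ∈ Y | G.Adj u w} = #(G.interedges X Y) := by
  simp only [SimpleGraph.interedges_def, card_filter, sum_product]

section DecidableGraph

variable {α : Type*} [DecidableEq α] (G : SimpleGraph α) [DecidableRel G.Adj]

/-- The independent sets of `G` contained in `X`: the configurations of the hard-core model. -/
def indepSets (X : Finset α) : Finset (Finset α) :=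
  {J ∈ X.powerset | G.IsIndepSet (J : Set α)}

/-- The partition function of the hard-core model on the subgraph of `G` induced by `X`, at
fugacity `z`: an independent set `J` is drawn with probability `z ^ #J / partitionFn G z X`. -/
def partitionFn (z : ℝ) (X : Finset α) : ℝ :=
  ∑ J ∈ indepSets G X, z ^ #J

/-- The expected size of a hard-core random independent subset of `X` at fugacity `z`, multiplied
by `partitionFn G z X`. -/
def occupancy (z : ℝ) (X : Finset α) : ℝ :=
  ∑ J ∈ indepSets G X, z ^ #J * #J

variable {G} {X Y A B : Finset α} {v : α} {z : ℝ}

theorem mem_indepSets {J : Finset α} :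
    J ∈ indepSets G X ↔ J ⊆ X ∧ ∀ a ∈ J, ∀ b ∈ J, ¬G.Adj a b := by
  simp only [indepSets, mem_filter, mem_powerset, SimpleGraph.isIndepSet_iff, Set.Pairwise, mem_coe]
  exact and_congr_right fun _ => ⟨fun h a ha b hb hab => h ha hb hab.ne hab,
    fun h a ha b hb _ => h a ha b hb⟩

theorem empty_mem_indepSets : ∅ ∈ indepSets G X := by
  simp [mem_indepSets]

theorem indepSets_mono (h : X ⊆ Y) : indepSets G X ⊆ indepSets G Y :=
  filter_subset_filter _ (powerset_mono.2 h)

theorem sum_indepSets_union {M : Type*} [AddCommMonoid M] (hAB : Disjoint A B)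
    (f : Finset α → M) :
    ∑ I ∈ indepSets G (A ∪ B), f I =
      ∑ S ∈ indepSets G A, ∑ J ∈ indepSets G {w ∈ B | ∀ s ∈ S, ¬G.Adj s w}, f (S ∪ J) := by
  rw [sum_sigma']
  refine sum_nbij' (fun I => ⟨I ∩ A, I ∩ B⟩) (fun p => p.1 ∪ p.2) ?_ ?_ ?_ ?_ ?_
  · intro I hI
    simp only [mem_sigma, mem_indepSets, subset_iff, mem_filter, mem_inter, mem_union] at hI ⊢
    grind
  · rintro ⟨S, J⟩ hSJ
    simp only [mem_sigma, mem_indepSets, subset_iff, mem_filter, mem_union] at hSJ ⊢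
    grind [G.adj_comm]
  · intro I hI
    rw [← inter_union_distrib_left, inter_eq_left.2 (mem_indepSets.1 hI).1]
  · rintro ⟨S, J⟩ hSJ
    simp only [mem_sigma, mem_indepSets, subset_iff, mem_filter] at hSJ
    rw [disjoint_left] at hAB
    simp only [Sigma.mk.injEq, heq_eq_eq]
    constructor <;> ext w <;> simp only [mem_inter, mem_union] <;> grind
  · intro I hI
    rw [← inter_union_distrib_left, inter_eq_left.2 (mem_indepSets.1 hI).1]

theorem sum_indepSets_insert {M : Type*} [AddCommMonoid M] (hv : v ∉ X) (f : Finset α → M) :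
    ∑ I ∈ indepSets G (insert v X), f I =
      ∑ J ∈ indepSets G X, f J + ∑ J ∈ indepSets G {w ∈ X | ¬G.Adj v w}, f (insert v J) := by
  have hsingleton : indepSets G {v} = {∅, {v}} := by
    ext J
    simp only [mem_indepSets, subset_singleton_iff, mem_insert, mem_singleton]
    grind [G.loopless.irrefl v]
  rw [insert_eq, sum_indepSets_union (disjoint_singleton_left.2 hv), hsingleton,
    sum_pair (singleton_ne_empty v).symm]
  simp only [notMem_empty, IsEmpty.forall_iff, implies_true, filter_true, empty_union,
    mem_singleton, forall_eq, singleton_union]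

theorem partitionFn_insert (hv : v ∉ X) :
    partitionFn G z (insert v X) =
      partitionFn G z X + z * partitionFn G z {w ∈ X | ¬G.Adj v w} := by
  rw [partitionFn, sum_indepSets_insert hv, partitionFn, partitionFn, mul_sum]
  congr 1
  refine sum_congr rfl fun J hJ => ?_
  have hvJ : v ∉ J := fun h => hv (mem_filter.1 ((mem_indepSets.1 hJ).1 h)).1
  rw [card_insert_of_notMem hvJ, pow_succ']

theorem occupancy_eq_sum :
    occupancy G z X = ∑ u ∈ X, z * partitionFn G z {w ∈ X.erase u | ¬G.Adj u w} := by
  have hcount : occupancy G z X = ∑ u ∈ X, ∑ J ∈ indepSets G X, if u ∈ J then z ^ #J else 0 := by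
    rw [occupancy, sum_comm]
    refine sum_congr rfl fun J hJ => ?_
    rw [sum_ite_mem, inter_eq_right.2 (mem_indepSets.1 hJ).1, sum_const, nsmul_eq_mul, mul_comm]
  rw [hcount]
  refine sum_congr rfl fun u hu => ?_
  conv_lhs => rw [← insert_erase hu]
  rw [sum_indepSets_insert (notMem_erase u X), partitionFn, mul_sum]
  have hnotMem : ∀ J ∈ indepSets G (X.erase u), u ∉ J := fun J hJ hJu =>
    notMem_erase u X ((mem_indepSets.1 hJ).1 hJu)
  rw [sum_eq_zero fun J hJ => if_neg (hnotMem J hJ), zero_add]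
  refine sum_congr rfl fun J hJ => ?_
  rw [if_pos (mem_insert_self u J), card_insert_of_notMem
    (hnotMem J (indepSets_mono (filter_subset _ _) hJ)), pow_succ']

theorem partitionFn_mono (hz : 0 ≤ z) (h : X ⊆ Y) : partitionFn G z X ≤ partitionFn G z Y :=
  sum_le_sum_of_subset_of_nonneg (indepSets_mono h) fun _ _ _ => pow_nonneg hz _

theorem one_le_partitionFn (hz : 0 ≤ z) : 1 ≤ partitionFn G z X := by
  have := single_le_sum (f := fun J : Finset α => z ^ #J) (fun J _ => pow_nonneg hz _)
    (empty_mem_indepSets (G := G) (X := X))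
  simpa [partitionFn] using this

theorem occupancy_nonneg (hz : 0 ≤ z) : 0 ≤ occupancy G z X :=
  sum_nonneg fun _ _ => by positivity

theorem partitionFn_le_exp (hz : 0 ≤ z) : partitionFn G z X ≤ Real.exp (z * #X) := by
  calc partitionFn G z X ≤ ∑ J ∈ X.powerset, z ^ #J :=
        sum_le_sum_of_subset_of_nonneg (filter_subset _ _) fun _ _ _ => pow_nonneg hz _
    _ = (z + 1) ^ #X := by simpa using sum_pow_mul_eq_add_pow z 1 X
    _ ≤ Real.exp z ^ #X := by gcongr; exact Real.add_one_le_exp z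
    _ = Real.exp (z * #X) := by rw [← Real.exp_nat_mul, mul_comm]

theorem partitionFn_le_sdiff_add (hz : 0 ≤ z) (A : Finset α) :
    partitionFn G z X ≤ partitionFn G z (X \ A) + #A * (z * partitionFn G z X) := by
  induction A using Finset.induction_on with
  | empty => simp
  | insert w A hw ih =>
    have hstep : partitionFn G z (X \ A) ≤
        partitionFn G z (X \ insert w A) + z * partitionFn G z X := by
      by_cases hwX : w ∈ X
      · have hsplit : X \ A = insert w (X \ insert w A) := by grind
        rw [hsplit, partitionFn_insert (by simp)]
        gcongr
        exact partitionFn_mono hz ((filter_subset _ _).trans sdiff_subset)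
      · have hsame : X \ insert w A = X \ A := by grind
        rw [hsame]
        exact le_add_of_nonneg_right (mul_nonneg hz (zero_le_one.trans (one_le_partitionFn hz)))
    rw [card_insert_of_notMem hw]
    push_cast
    linarith

theorem partitionFn_mul_one_sub_le (hz : 0 ≤ z) (hv : v ∈ X) :
    partitionFn G z X * (1 - z * #{w ∈ X | G.Adj v w}) ≤
      (1 + z) * partitionFn G z {w ∈ X.erase v | ¬G.Adj v w} := by
  have hdel := partitionFn_le_sdiff_add (G := G) (X := X) hz {w ∈ X | G.Adj v w}
  have hisolated : X \ {w ∈ X | G.Adj v w} = insert v {w ∈ X.erase v | ¬G.Adj v w} := by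
    grind [G.loopless.irrefl v]
  rw [hisolated, partitionFn_insert (by simp), filter_filter] at hdel
  simp only [and_self] at hdel
  linarith

/-- In a sparse set the hard-core model is close to a binomial random set of density `z`. -/
theorem partitionFn_mul_sub_one_le_occupancy (hz : 0 ≤ z) (hz1 : z ≤ 1)
    (hX : z ^ 2 * #(G.interedges X X) ≤ 1) :
    partitionFn G z X * (z * #X - 1) ≤ 2 * occupancy G z X := by
  have hZ : 1 ≤ partitionFn G z X := one_le_partitionFn hz
  have hsum : partitionFn G z X * (z * #X - z ^ 2 * #(G.interedges X X)) ≤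
      (1 + z) * occupancy G z X := by
    calc partitionFn G z X * (z * #X - z ^ 2 * #(G.interedges X X))
        = ∑ u ∈ X, z * (partitionFn G z X * (1 - z * #{w ∈ X | G.Adj u w})) := by
          rw [← mul_sum, ← mul_sum, sum_sub_distrib, ← mul_sum, ← Nat.cast_sum,
            sum_card_filter_adj, sum_const, nsmul_eq_mul]
          ring
      _ ≤ ∑ u ∈ X, z * ((1 + z) * partitionFn G z {w ∈ X.erase u | ¬G.Adj u w}) :=
          sum_le_sum fun u hu =>
            mul_le_mul_of_nonneg_left (partitionFn_mul_one_sub_le hz hu) hz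
      _ = (1 + z) * occupancy G z X := by
          rw [occupancy_eq_sum, mul_sum]
          exact sum_congr rfl fun u _ => by ring
  have hocc : 0 ≤ occupancy G z X := occupancy_nonneg hz
  calc partitionFn G z X * (z * #X - 1)
      ≤ partitionFn G z X * (z * #X - z ^ 2 * #(G.interedges X X)) := by gcongr
    _ ≤ (1 + z) * occupancy G z X := hsum
    _ ≤ 2 * occupancy G z X := by gcongr; linarith

theorem partitionFn_mul_log_sub_one_le_occupancy (hz : 0 ≤ z) (hz1 : z ≤ 1)
    (hX : z ^ 2 * #(G.interedges X X) ≤ 1) :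
    partitionFn G z X * (Real.log (partitionFn G z X) - 1) ≤ 2 * occupancy G z X := by
  have hZ : 0 < partitionFn G z X := zero_lt_one.trans_le (one_le_partitionFn hz)
  refine le_trans ?_ (partitionFn_mul_sub_one_le_occupancy hz hz1 hX)
  gcongr
  exact (Real.log_le_iff_le_exp hZ).2 (partitionFn_le_exp hz)

variable (G) in
/-- A vertex `v` charges an independent set `I` by `D` if `v ∈ I`, and by `1` for each neighbour
of `v` in `I`. -/
def charge (D : ℝ) (v : α) (I : Finset α) : ℝ :=
  (if v ∈ I then D else 0) + #{w ∈ I | G.Adj v w}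

theorem mul_partitionFn_le_sum_charge_of_forall_adj {D m : ℝ} (hz : 0 ≤ z) (hz1 : z ≤ 1)
    (hm : 0 ≤ m) (hD : Real.exp (4 * m) ≤ z * D) (hX : z ^ 2 * #(G.interedges X X) ≤ 1)
    (hv : ∀ w ∈ X, G.Adj v w) :
    m * partitionFn G z (insert v X) ≤
      ∑ J ∈ indepSets G (insert v X), z ^ #J * charge G D v J := by
  have hvX : v ∉ X := fun h => G.loopless.irrefl v (hv v h)
  have hfree : {w ∈ X | ¬G.Adj v w} = ∅ := filter_eq_empty_iff.2 fun w hw => not_not.2 (hv w hw)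
  have hcharge : ∑ J ∈ indepSets G (insert v X), z ^ #J * charge G D v J =
      occupancy G z X + z * D := by
    have hempty : indepSets G (∅ : Finset α) = {∅} := by ext; simp +contextual [mem_indepSets]
    rw [sum_indepSets_insert hvX, hfree, hempty, sum_singleton, occupancy]
    congr 1
    · refine sum_congr rfl fun J hJ => ?_
      have hJX := (mem_indepSets.1 hJ).1
      rw [charge, if_neg fun h => hvX (hJX h), filter_true_of_mem fun w hw => hv w (hJX hw),
        zero_add]
    · simp [charge, filter_singleton]
  have hZ : 1 ≤ partitionFn G z X := one_le_partitionFn hz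
  have hocc := partitionFn_mul_log_sub_one_le_occupancy hz hz1 hX
  have hyoung := mul_le_exp_add_mul_log_sub_one (zero_lt_one.trans_le hZ) (4 * m)
  rw [hcharge, partitionFn_insert hvX, hfree]
  have hZempty : partitionFn G z ∅ = 1 := by
    simp [partitionFn, indepSets, filter_singleton]
  rw [hZempty, mul_one]
  have hmz : m * z ≤ Real.exp (4 * m) / 4 :=
    (mul_le_of_le_one_right hm hz1).trans (by linarith [Real.add_one_le_exp (4 * m)])
  linarith [Real.exp_pos (4 * m), occupancy_nonneg (G := G) (X := X) hz]

theorem mul_sum_union_le_sum_union_charge {D m : ℝ} (hz : 0 ≤ z) (hz1 : z ≤ 1) (hm : 0 ≤ m)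
    (hD : Real.exp (4 * m) ≤ z * D)
    {N : Finset α} (hN : ∀ w, w ∈ N ↔ G.Adj v w) (hsparse : z ^ 2 * #(G.interedges N N) ≤ 1)
    {S : Finset α} (hS : Disjoint S (insert v N)) :
    m * ∑ J ∈ indepSets G {w ∈ insert v N | ∀ s ∈ S, ¬G.Adj s w}, z ^ #(S ∪ J) ≤
      ∑ J ∈ indepSets G {w ∈ insert v N | ∀ s ∈ S, ¬G.Adj s w},
        z ^ #(S ∪ J) * charge G D v (S ∪ J) := by
  have hvS : v ∉ S := disjoint_right.1 hS (mem_insert_self v _)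
  have hSadj : ∀ w ∈ S, ¬G.Adj v w := fun w hw h =>
    disjoint_left.1 hS hw (mem_insert_of_mem ((hN w).2 h))
  set X := {w ∈ N | ∀ s ∈ S, ¬G.Adj s w}
  have hcard : ∀ J ∈ indepSets G (insert v X), #(S ∪ J) = #S + #J := fun J hJ =>
    card_union_of_disjoint <| hS.mono_right <|
      (mem_indepSets.1 hJ).1.trans (insert_subset_insert v (filter_subset _ _))
  have hcharge : ∀ J, charge G D v (S ∪ J) = charge G D v J := fun J => by
    simp only [charge, mem_union, hvS, false_or, filter_union, filter_false_of_mem hSadj,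
      empty_union]
  have hsparseX : z ^ 2 * #(G.interedges X X) ≤ 1 := by
    refine le_trans ?_ hsparse
    gcongr
    exact G.interedges_mono (filter_subset _ _) (filter_subset _ _)
  have hlocal := mul_partitionFn_le_sum_charge_of_forall_adj hz hz1 hm hD hsparseX
    fun w hw => (hN w).1 (mem_filter.1 hw).1
  rw [filter_insert, if_pos fun s hs h => hSadj s hs h.symm]
  calc m * ∑ J ∈ indepSets G (insert v X), z ^ #(S ∪ J)
      = z ^ #S * (m * partitionFn G z (insert v X)) := by
        rw [partitionFn, mul_left_comm, mul_sum (indepSets G (insert v X)) _ (z ^ #S)]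
        congr 1
        exact sum_congr rfl fun J hJ => by rw [hcard J hJ, pow_add]
    _ ≤ z ^ #S * ∑ J ∈ indepSets G (insert v X), z ^ #J * charge G D v J := by gcongr
    _ = ∑ J ∈ indepSets G (insert v X), z ^ #(S ∪ J) * charge G D v (S ∪ J) := by
        rw [mul_sum]
        exact sum_congr rfl fun J hJ => by rw [hcard J hJ, hcharge, pow_add, mul_assoc]

end DecidableGraph

section DecidableFintype

variable {α : Type*} [Fintype α] [DecidableEq α] {G : SimpleGraph α} [DecidableRel G.Adj]
  {v : α} {z : ℝ}

theorem mul_partitionFn_le_sum_charge {D m : ℝ} (hz : 0 ≤ z) (hz1 : z ≤ 1) (hm : 0 ≤ m)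
    (hD : Real.exp (4 * m) ≤ z * D)
    (hv : z ^ 2 * #(G.interedges (G.neighborFinset v) (G.neighborFinset v)) ≤ 1) :
    m * partitionFn G z univ ≤ ∑ I ∈ indepSets G univ, z ^ #I * charge G D v I := by
  have hdisj : Disjoint (insert v (G.neighborFinset v))ᶜ (insert v (G.neighborFinset v)) :=
    disjoint_compl_left
  have hsplit (f : Finset α → ℝ) := sum_indepSets_union (G := G) hdisj f
  rw [union_comm, union_compl] at hsplit
  rw [partitionFn, hsplit, hsplit, mul_sum]
  exact sum_le_sum fun S hS => mul_sum_union_le_sum_union_charge hz hz1 hm hD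
    (G.mem_neighborFinset v) hv (hdisj.mono_left (mem_indepSets.1 hS).1)

theorem sum_charge_le {D : ℝ} (hdeg : ∀ v, G.degree v ≤ D) (I : Finset α) :
    ∑ v, charge G D v I ≤ 2 * D * #I := by
  have hmem : ∑ v, (if v ∈ I then D else 0) = #I * D := by
    rw [sum_ite_mem, univ_inter, sum_const, nsmul_eq_mul]
  have hadj : ∑ v, (#{w ∈ I | G.Adj v w} : ℝ) ≤ #I * D := by
    calc ∑ v, (#{w ∈ I | G.Adj v w} : ℝ) = ∑ w ∈ I, (G.degree w : ℝ) := by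
          simp only [card_filter, ← G.card_neighborFinset_eq_degree, G.neighborFinset_eq_filter]
          push_cast
          rw [sum_comm]
          simp only [G.adj_comm]
      _ ≤ #I * D := by
          rw [← nsmul_eq_mul]
          exact sum_le_card_nsmul _ _ _ fun w _ => hdeg w
  calc ∑ v, charge G D v I ≤ #I * D + #I * D := by
        simp only [charge, sum_add_distrib, hmem]
        gcongr
    _ = 2 * D * #I := by ring

end DecidableFintype

section Fintype

variable {α : Type*} [Fintype α] {G : SimpleGraph α} [DecidableRel G.Adj]

theorem mul_card_le_mul_indepNum {z D m : ℝ} (hz : 0 ≤ z) (hz1 : z ≤ 1) (hm : 0 ≤ m)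
    (hD : Real.exp (4 * m) ≤ z * D) (hdeg : ∀ v, G.degree v ≤ D)
    (hsparse : ∀ v, z ^ 2 * #(G.interedges (G.neighborFinset v) (G.neighborFinset v)) ≤ 1) :
    m * Fintype.card α ≤ 2 * D * G.indepNum := by
  classical
  have hZ : 0 < partitionFn G z univ := zero_lt_one.trans_le (one_le_partitionFn hz)
  have hD0 : 0 ≤ D := by
    by_contra! h
    linarith [Real.exp_pos (4 * m), mul_nonpos_of_nonneg_of_nonpos hz h.le]
  refine le_of_mul_le_mul_right ?_ hZ
  calc m * Fintype.card α * partitionFn G z univ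
      = ∑ _v : α, m * partitionFn G z univ := by
        rw [sum_const, card_univ, nsmul_eq_mul]
        ring
    _ ≤ ∑ v, ∑ I ∈ indepSets G univ, z ^ #I * charge G D v I :=
        sum_le_sum fun v _ => mul_partitionFn_le_sum_charge hz hz1 hm hD (hsparse v)
    _ = ∑ I ∈ indepSets G univ, z ^ #I * ∑ v, charge G D v I := by
        simp only [sum_comm (s := univ), mul_sum]
    _ ≤ ∑ I ∈ indepSets G univ, z ^ #I * (2 * D * G.indepNum) := by
        gcongr with I hI
        refine (sum_charge_le hdeg I).trans ?_
        gcongr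
        exact SimpleGraph.IsIndepSet.card_le_indepNum (mem_filter.1 hI).2
    _ = 2 * D * G.indepNum * partitionFn G z univ := by rw [← sum_mul, mul_comm, partitionFn]

theorem card_mul_log_le_mul_indepNum {D T : ℕ} (hT : 0 < T) (hdeg : ∀ v, G.degree v ≤ D)
    (hsparse : ∀ v, #(G.interedges (G.neighborFinset v) (G.neighborFinset v)) ≤ T) :
    Fintype.card α * Real.log (D / √T) ≤ 8 * D * G.indepNum := by
  rcases le_or_gt (Real.log (D / √T)) 0 with hlog | hlog
  · exact (mul_nonpos_of_nonneg_of_nonpos (by positivity) hlog).trans (by positivity)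
  have hsqrt : 1 ≤ √(T : ℝ) := Real.one_le_sqrt.2 (by exact_mod_cast hT)
  have hexp : Real.exp (4 * (Real.log (D / √T) / 4)) ≤ (√T)⁻¹ * D := by
    have hpos : 0 < D / √(T : ℝ) :=
      (div_nonneg D.cast_nonneg (Real.sqrt_nonneg _)).lt_of_ne fun h => by simp [← h] at hlog
    rw [mul_div_cancel₀ _ four_ne_zero, Real.exp_log hpos, div_eq_inv_mul]
  have hsparse' (v : α) :
      (√T)⁻¹ ^ 2 * (#(G.interedges (G.neighborFinset v) (G.neighborFinset v)) : ℝ) ≤ 1 := by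
    rw [inv_pow, Real.sq_sqrt T.cast_nonneg]
    exact inv_mul_le_one_of_le₀ (by exact_mod_cast hsparse v) T.cast_nonneg
  have := mul_card_le_mul_indepNum (z := (√T)⁻¹) (by positivity) (inv_le_one_of_one_le₀ hsqrt)
    (by positivity) hexp (fun v => by exact_mod_cast hdeg v) hsparse'
  linarith

theorem card_le_mul_indepNum {D : ℕ} (hdeg : ∀ v, G.degree v < D) :
    Fintype.card α ≤ D * G.indepNum := by
  classical
  obtain ⟨I, hI⟩ := G.exists_isNIndepSet_indepNum
  have hcover : univ ⊆ I.biUnion fun v => insert v (G.neighborFinset v) := by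
    intro u _
    by_contra hu
    simp only [mem_biUnion, mem_insert, SimpleGraph.mem_neighborFinset, not_exists, not_and,
      not_or] at hu
    have huI : u ∉ I := fun h => (hu u h).1 rfl
    have hins : G.IsIndepSet (insert u I : Finset α) := by
      rw [coe_insert, SimpleGraph.isIndepSet_iff, Set.pairwise_insert]
      exact ⟨hI.1, fun w hw _ => ⟨fun h => (hu w hw).2 h.symm, (hu w hw).2⟩⟩
    have := hins.card_le_indepNum
    rw [card_insert_of_notMem huI, hI.2] at this
    omega
  calc Fintype.card α ≤ #(I.biUnion fun v => insert v (G.neighborFinset v)) := card_le_card hcover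
    _ ≤ #I * D := card_biUnion_le_card_mul _ _ _ fun v _ => (card_insert_le _ _).trans (hdeg v)
    _ = D * G.indepNum := by rw [hI.2, mul_comm]

end Fintype

end HardCore

namespace BinaryCode

section Entropy

open Real

theorem log_le_mul_add_inv {a x : ℝ} (ha : 0 < a) (hx : 0 < x) : log x ≤ a * x + a⁻¹ - 2 := by
  have hprod := log_le_sub_one_of_pos (mul_pos ha hx)
  have hinv := log_le_sub_one_of_pos (inv_pos.2 ha)
  rw [log_mul ha.ne' hx.ne'] at hprod
  rw [log_inv] at hinv
  linarith

/-- The logarithm of the odds `(1 - p) / p`, which is the derivative of `Real.binEntropy` at `p`. -/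
noncomputable def logOdds (p : ℝ) : ℝ := log (1 - p) - log p

theorem binEntropy_eq_mul_logOdds_sub (p : ℝ) : binEntropy p = p * logOdds p - log (1 - p) := by
  rw [binEntropy, logOdds, log_inv, log_inv]
  ring

variable {p : ℝ} {n r : ℕ}

theorem le_logOdds (hp : 0 < p) (hp2 : p ≤ 1 / 2) :
    2 * (1 - 2 * p) + 2 / 3 * (1 - 2 * p) ^ 3 ≤ logOdds p := by
  have hseries := sum_range_le_log_div (x := 1 - 2 * p) (by linarith) (by linarith) 2
  have hodds : (1 + (1 - 2 * p)) / (1 - (1 - 2 * p)) = (1 - p) / p := by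
    field_simp
    ring
  rw [hodds, log_div (by linarith) hp.ne', ← logOdds, Finset.sum_range_succ,
    Finset.sum_range_one] at hseries
  norm_num at hseries
  linarith

theorem logOdds_nonneg (hp : 0 < p) (hp2 : p ≤ 1 / 2) : 0 ≤ logOdds p :=
  sub_nonneg.2 (log_le_log hp (by linarith))

theorem two_mul_le_logOdds {u : ℝ} (hp : 0 < p) (hu : 0 ≤ u) (hup : u ≤ 1 - 2 * p) :
    2 * u ≤ logOdds p := by
  have hcube : 0 ≤ (1 - 2 * p) ^ 3 := pow_nonneg (hu.trans hup) 3
  linarith [le_logOdds hp (by linarith)]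

theorem sq_mul_logOdds_le {u : ℝ} (hp : 0 < p) (hu : 0 ≤ u) (hup : u ≤ 1 - 2 * p) :
    u ^ 2 / 4 * logOdds p ≤ logOdds p - 2 * (1 - 2 * p) := by
  set w := 1 - 2 * p with hw
  have hw1 : w ≤ 1 := by linarith only [hp, hw]
  have hw0 : 0 ≤ w := hu.trans hup
  have hodds : 2 * w + 2 / 3 * w ^ 3 ≤ logOdds p := le_logOdds hp (by linarith)
  have hu4 : u ^ 2 / 4 ≤ w ^ 2 / 4 := by gcongr
  have hw2 : w ^ 2 ≤ 1 := pow_le_one₀ hw0 hw1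
  calc u ^ 2 / 4 * logOdds p ≤ w ^ 2 / 4 * logOdds p := by
        gcongr
        exact logOdds_nonneg hp (by linarith)
    _ = logOdds p - (1 - w ^ 2 / 4) * logOdds p := by ring
    _ ≤ logOdds p - (1 - w ^ 2 / 4) * (2 * w + 2 / 3 * w ^ 3) := by
        gcongr
        linarith
    _ = logOdds p - 2 * w - w ^ 3 / 6 * (1 - w ^ 2) := by ring
    _ ≤ logOdds p - 2 * w :=
        sub_le_self _ (mul_nonneg (by positivity) (sub_nonneg.2 hw2))

theorem binEntropy_le_mul_logOdds_add (hp : 0 < p) (hp2 : p ≤ 1 / 2) :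
    binEntropy p ≤ p * (logOdds p + 2) := by
  have hlog := one_sub_inv_le_log_of_pos (x := 1 - p) (by linarith)
  have hinv : (1 - p)⁻¹ ≤ 1 + 2 * p := by
    rw [inv_le_iff_one_le_mul₀ (by linarith)]
    nlinarith
  rw [binEntropy_eq_mul_logOdds_sub]
  linarith

theorem log_factorial_le (hn : n ≠ 0) :
    log n.factorial ≤ n * log n - n + log n / 2 + 1 := by
  obtain ⟨k, rfl⟩ := Nat.exists_eq_succ_of_ne_zero hn
  have hanti := Stirling.log_stirlingSeq'_antitone (Nat.zero_le k)
  have hk : ((k.succ : ℕ) : ℝ) ≠ 0 := by positivity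
  simp only [Function.comp_apply] at hanti
  rw [Stirling.stirlingSeq_one, log_div (exp_ne_zero 1) (by positivity), log_exp,
    log_sqrt zero_le_two, Stirling.log_stirlingSeq_formula, log_mul two_ne_zero hk,
    log_div hk (exp_ne_zero 1), log_exp] at hanti
  linarith

theorem mul_binEntropy_div (hr : 0 < r) (hrn : r < n) :
    n * binEntropy (r / n) = n * log n - r * log r - (n - r) * log (n - r) := by
  have hr0 : (0 : ℝ) < r := by exact_mod_cast hr
  have hrn0 : (0 : ℝ) < n - r := sub_pos.2 (by exact_mod_cast hrn)
  have hn0 : (0 : ℝ) < n := by linarith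
  rw [binEntropy, one_sub_div hn0.ne', inv_div, inv_div, log_div hn0.ne' hr0.ne',
    log_div hn0.ne' hrn0.ne']
  field_simp
  ring

theorem mul_binEntropy_le_log_choose (hr : 0 < r) (hrn : r < n) :
    n * binEntropy (r / n) ≤ log (n.choose r) + log r / 2 + 2 := by
  have hsub : ((n - r : ℕ) : ℝ) = n - r := Nat.cast_sub hrn.le
  have hchoose : log (n.choose r) =
      log n.factorial - log r.factorial - log (n - r).factorial := by
    rw [Nat.choose_eq_factorial_div_factorial hrn.le,
      Nat.cast_div (Nat.factorial_mul_factorial_dvd_factorial hrn.le) (by positivity),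
      Nat.cast_mul, log_div (by positivity) (by positivity),
      log_mul (by positivity) (by positivity)]
    ring
  have hn := Stirling.le_log_factorial_stirling (hr.trans hrn).ne'
  have hr' := log_factorial_le hr.ne'
  have hnr := log_factorial_le (Nat.sub_pos_of_lt hrn).ne'
  have hlog : log (n - r : ℕ) ≤ log n :=
    log_le_log (by exact_mod_cast Nat.sub_pos_of_lt hrn) (by exact_mod_cast n.sub_le r)
  have hpi : 0 ≤ log (2 * π) := log_nonneg (by linarith [pi_gt_three])
  rw [hsub] at hnr hlog
  rw [mul_binEntropy_div hr hrn, hchoose]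
  linarith

end Entropy

section CodeGraph

open Finset

theorem V_pos (n r : ℕ) : 0 < V n r :=
  sum_pos' (fun _ _ => Nat.zero_le _) ⟨0, by simp⟩

theorem choose_le_V (n r : ℕ) : n.choose r ≤ V n r :=
  single_le_sum (f := n.choose) (fun _ _ => Nat.zero_le _) (self_mem_range_succ r)

theorem V_mul_pow_le {n r : ℕ} (hrn : r ≤ n) {x : ℝ} (hx : 0 ≤ x) (hx1 : x ≤ 1) :
    V n r * x ^ r ≤ (1 + x) ^ n := by
  calc (V n r : ℝ) * x ^ r = ∑ i ∈ range (r + 1), x ^ r * n.choose i := by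
        rw [V, Nat.cast_sum, mul_comm, mul_sum]
    _ ≤ ∑ i ∈ range (r + 1), x ^ i * n.choose i := by
        gcongr ∑ i ∈ _, ?_ * _ with i hi
        exact pow_le_pow_of_le_one hx hx1 (Nat.lt_succ_iff.1 (mem_range.1 hi))
    _ ≤ ∑ i ∈ range (n + 1), x ^ i * n.choose i :=
        sum_le_sum_of_subset_of_nonneg (range_subset_range.2 (by lia)) fun i _ _ => by positivity
    _ = (1 + x) ^ n := by simp [add_comm 1 x, add_pow]

variable {n r : ℕ}

theorem card_closedBall_le_V (v : Fin n → ZMod 2) : #{x | hammingDist v x ≤ r} ≤ V n r := by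
  have hinj : ∀ a b c : ZMod 2, (a ≠ b ↔ a ≠ c) → b = c := by decide
  calc #{x | hammingDist v x ≤ r}
      ≤ #((range (r + 1)).biUnion fun i => powersetCard i (univ : Finset (Fin n))) := by
        refine card_le_card_of_injOn (fun x => ({i | v i ≠ x i} : Finset (Fin n))) ?_ ?_
        · intro x hx
          simpa [Nat.lt_succ_iff, hammingDist] using hx
        · intro x _ y _ hxy
          ext1 i
          exact hinj (v i) _ _ (by simpa using Finset.ext_iff.1 hxy i)
    _ ≤ ∑ i ∈ range (r + 1), #(powersetCard i (univ : Finset (Fin n))) := card_biUnion_le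
    _ = V n r := by simp only [card_powersetCard, card_fin, V]

/-- The graph on `𝔽₂ⁿ` joining distinct words at distance at most `r`; its independent sets are the
codes of minimum distance `r + 1`. -/
def codeGraph (n r : ℕ) : SimpleGraph (Fin n → ZMod 2) where
  Adj x y := x ≠ y ∧ hammingDist x y ≤ r
  symm := ⟨fun x y h => ⟨h.1.symm, hammingDist_comm x y ▸ h.2⟩⟩
  loopless := ⟨fun _ h => h.1 rfl⟩

instance : DecidableRel (codeGraph n r).Adj :=
  fun x y => inferInstanceAs (Decidable (x ≠ y ∧ hammingDist x y ≤ r))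

theorem codeGraph_adj {x y : Fin n → ZMod 2} :
    (codeGraph n r).Adj x y ↔ x ≠ y ∧ hammingDist x y ≤ r :=
  Iff.rfl

theorem isIndepSet_codeGraph {C : Finset (Fin n → ZMod 2)} :
    (codeGraph n r).IsIndepSet C ↔ HasMinDist (r + 1) C := by
  simp only [SimpleGraph.isIndepSet_iff, Set.Pairwise, mem_coe, codeGraph_adj, HasMinDist, not_and,
    not_le, Nat.succ_le_iff]
  exact ⟨fun h x hx y hy hxy => h hx hy hxy hxy, fun h x hx y hy hxy _ => h x hx y hy hxy⟩

theorem A₂_eq_indepNum : A₂ n (r + 1) = (codeGraph n r).indepNum := by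
  simp only [A₂, SimpleGraph.indepNum, SimpleGraph.isNIndepSet_iff, isIndepSet_codeGraph]

theorem codeGraph_degree_lt (v : Fin n → ZMod 2) : (codeGraph n r).degree v < V n r := by
  refine lt_of_lt_of_le ?_ (card_closedBall_le_V v)
  refine card_lt_card ((ssubset_iff_of_subset fun x hx => ?_).2 ⟨v, ?_, ?_⟩)
  · exact mem_filter.2 ⟨mem_univ x, ((SimpleGraph.mem_neighborFinset _ _ _).1 hx).2⟩
  · simp
  · simp

theorem gilbert_varshamov (n r : ℕ) : 2 ^ n ≤ V n r * A₂ n (r + 1) := by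
  have := HardCore.card_le_mul_indepNum (codeGraph_degree_lt (n := n) (r := r))
  simpa [A₂_eq_indepNum] using this

/-- The number of pairs of words forming with the origin a triangle of diameter at most `r`,
degenerate triangles included. -/
def triangleCount (n r : ℕ) : ℕ :=
  #{p : (Fin n → ZMod 2) × (Fin n → ZMod 2) |
    hammingNorm p.1 ≤ r ∧ hammingNorm p.2 ≤ r ∧ hammingDist p.1 p.2 ≤ r}

theorem triangleCount_pos (n r : ℕ) : 0 < triangleCount n r :=
  card_pos.2 ⟨0, by simp⟩

theorem card_interedges_codeGraph_le (v : Fin n → ZMod 2) :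
    #((codeGraph n r).interedges ((codeGraph n r).neighborFinset v)
      ((codeGraph n r).neighborFinset v)) ≤ triangleCount n r := by
  refine card_le_card_of_injOn (fun p => (-v + p.1, -v + p.2)) ?_ ?_
  · rintro ⟨y, z⟩ hyz
    obtain ⟨hy, hz, hyz⟩ : (v ≠ y ∧ hammingDist v y ≤ r) ∧ (v ≠ z ∧ hammingDist v z ≤ r) ∧
        y ≠ z ∧ hammingDist y z ≤ r := by
      simpa [SimpleGraph.mem_interedges_iff, codeGraph_adj] using hyz
    have htranslate : hammingDist (-v + y) (-v + z) = hammingDist y z :=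
      hammingDist_comp (fun i => (-v i + ·)) fun i => add_right_injective (-v i)
    simp [htranslate, ← hammingDist_eq_hammingNorm, hy.2, hz.2, hyz.2]
  · rintro ⟨y, z⟩ _ ⟨y', z'⟩ _ h
    simpa using h

theorem pow_hammingDist (x : ℝ) (y z : Fin n → ZMod 2) :
    x ^ hammingDist y z = ∏ i, if y i ≠ z i then x else 1 := by
  rw [prod_ite, prod_const, prod_const_one, mul_one, hammingDist]

theorem sum_pow_hammingNorm_add_hammingDist (n : ℕ) (x : ℝ) :
    ∑ p : (Fin n → ZMod 2) × (Fin n → ZMod 2),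
      x ^ (hammingNorm p.1 + hammingNorm p.2 + hammingDist p.1 p.2) = (1 + 3 * x ^ 2) ^ n := by
  have hcoord : 1 + 3 * x ^ 2 = ∑ a : ZMod 2 × ZMod 2, (if 0 ≠ a.1 then x else 1) *
      (if 0 ≠ a.2 then x else 1) * (if a.1 ≠ a.2 then x else 1) := by
    rw [Fintype.sum_prod_type, show (univ : Finset (ZMod 2)) = {0, 1} from rfl]
    simp only [ne_eq, ite_not, mul_ite, mul_one, ite_mul, one_mul, mem_singleton, zero_ne_one,
      not_false_eq_true, sum_insert, ↓reduceIte, sum_singleton, one_ne_zero]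
    ring
  rw [hcoord, Fintype.sum_pow, ← (Equiv.arrowProdEquivProdArrow (Fin n) _ _).sum_comp]
  refine sum_congr rfl fun p _ => ?_
  simp only [pow_add, ← hammingDist_zero_left, pow_hammingDist, prod_mul_distrib,
    Equiv.arrowProdEquivProdArrow_apply, Pi.zero_apply]

theorem triangleCount_mul_pow_le (n r : ℕ) {x : ℝ} (hx : 0 ≤ x) (hx1 : x ≤ 1) :
    triangleCount n r * x ^ (3 * r) ≤ (1 + 3 * x ^ 2) ^ n := by
  rw [← sum_pow_hammingNorm_add_hammingDist, triangleCount, ← nsmul_eq_mul]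
  refine (card_nsmul_le_sum _ _ _ fun p hp => ?_).trans
    (sum_le_sum_of_subset_of_nonneg (filter_subset _ _) fun p _ _ => by positivity)
  have := (mem_filter.1 hp).2
  exact pow_le_pow_of_le_one hx hx1 (by lia)

theorem two_pow_mul_log_le (n r : ℕ) :
    2 ^ n * Real.log (V n r / √(triangleCount n r)) ≤ 8 * V n r * A₂ n (r + 1) := by
  have := HardCore.card_mul_log_le_mul_indepNum (triangleCount_pos n r)
    (fun v => (codeGraph_degree_lt v).le) card_interedges_codeGraph_le
  simpa [A₂_eq_indepNum] using this

end CodeGraph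

section LogBounds

open Real

variable {p : ℝ} {n r : ℕ}

theorem log_V_le (hp : 0 < p) (hp2 : p ≤ 1 / 2) (hr : r ≤ p * n) :
    log (V n r) ≤ n * binEntropy p := by
  have hq : 0 < 1 - p := by linarith
  have hV : (0 : ℝ) < V n r := by exact_mod_cast V_pos n r
  have hrn : r ≤ n := by
    have : (r : ℝ) ≤ n := hr.trans (mul_le_of_le_one_left n.cast_nonneg (by linarith))
    exact_mod_cast this
  have hodds : 1 + p / (1 - p) = (1 - p)⁻¹ := by
    field_simp
    ring
  have hgen := V_mul_pow_le hrn (x := p / (1 - p)) (by positivity)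
    ((div_le_one hq).2 (by linarith))
  have hlog := log_le_log (by positivity) hgen
  rw [hodds, log_mul hV.ne' (by positivity), log_pow, log_pow, log_inv,
    log_div hp.ne' hq.ne'] at hlog
  have hmono := mul_le_mul_of_nonneg_right hr (logOdds_nonneg hp hp2)
  rw [binEntropy_eq_mul_logOdds_sub]
  rw [logOdds] at hmono ⊢
  linarith

theorem half_mul_log_V_le {u : ℝ} (hp : 0 < p) (hu : 0 ≤ u) (hup : u ≤ 1 - 2 * p)
    (hr : r ≤ p * n) : u / 2 * log (V n r) ≤ n * (p * logOdds p) := by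
  have hp2 : p ≤ 1 / 2 := by linarith
  calc u / 2 * log (V n r) ≤ u / 2 * (n * (p * (logOdds p + 2))) := by
        gcongr
        exact (log_V_le hp hp2 hr).trans (by gcongr; exact binEntropy_le_mul_logOdds_add hp hp2)
    _ = n * (p * ((u * logOdds p + 2 * u) / 2)) := by ring
    _ ≤ n * (p * ((1 * logOdds p + logOdds p) / 2)) := by
        gcongr
        · exact logOdds_nonneg hp hp2
        · linarith
        · exact two_mul_le_logOdds hp hu hup
    _ = n * (p * logOdds p) := by ring

theorem log_triangleCount_le_binEntropy (hp : 0 < p) (hp2 : p ≤ 1 / 2) (hr : r ≤ p * n) :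
    log (triangleCount n r) ≤
      n * (2 * binEntropy p - p / 2 * (logOdds p - 2 * (1 - 2 * p))) := by
  have hq : 0 < 1 - p := by linarith
  have hT : (0 : ℝ) < triangleCount n r := by exact_mod_cast triangleCount_pos n r
  have hodds : 1 + 3 * (p / (1 - p)) = (1 + 2 * p) / (1 - p) := by
    field_simp
    ring
  have hgen := triangleCount_mul_pow_le n r (sqrt_nonneg (p / (1 - p)))
    (sqrt_le_one.2 ((div_le_one hq).2 (by linarith)))
  rw [sq_sqrt (by positivity), hodds] at hgen
  have hlog := log_le_log (by positivity) hgen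
  rw [log_mul hT.ne' (by positivity), log_pow, log_pow, log_sqrt (by positivity),
    log_div hp.ne' hq.ne', log_div (by positivity) hq.ne'] at hlog
  push_cast at hlog
  have hmono := mul_le_mul_of_nonneg_right hr (logOdds_nonneg hp hp2)
  have hprod : log (1 + 2 * p) + log (1 - p) ≤ p * (1 - 2 * p) := by
    rw [← log_mul (by positivity) hq.ne']
    linarith [log_le_sub_one_of_pos (x := (1 + 2 * p) * (1 - p)) (by positivity)]
  have hprod_n := mul_le_mul_of_nonneg_left hprod n.cast_nonneg
  rw [binEntropy_eq_mul_logOdds_sub]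
  rw [logOdds] at hmono ⊢
  linarith

theorem log_triangleCount_le_log_V (hr : 0 < r) (hrn : 2 * r ≤ n) :
    log (triangleCount n r) ≤ 2 * log (V n r) + log r + 4 -
      r / 2 * (logOdds (r / n) - 2 * (1 - 2 * (r / n))) := by
  have hn0 : (0 : ℝ) < n := by exact_mod_cast (by lia : 0 < n)
  have hp2 : (r : ℝ) / n ≤ 1 / 2 := by
    rw [div_le_div_iff₀ hn0 two_pos, one_mul, mul_comm]
    exact_mod_cast hrn
  have hpn : (r : ℝ) / n * n = r := div_mul_cancel₀ _ hn0.ne'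
  have htriangle := log_triangleCount_le_binEntropy (by positivity) hp2 hpn.ge
  have hchoose : log (n.choose r) ≤ log (V n r) :=
    log_le_log (by exact_mod_cast Nat.choose_pos (by lia)) (by exact_mod_cast choose_le_V n r)
  have hentropy := mul_binEntropy_le_log_choose hr (by lia : r < n)
  have hscale (x : ℝ) : n * (r / n / 2 * x) = r / 2 * x := by
    rw [← hpn]
    field_simp
  rw [mul_sub, hscale] at htriangle
  linarith

theorem log_triangleCount_le {u : ℝ} (hu : 0 < u) (hr : 0 < r) (hrn : 2 * r ≤ (1 - u) * n) :
    log (triangleCount n r) ≤ (2 - u ^ 3 / 32) * log (V n r) + 8 / u ^ 3 + 2 := by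
  have hr0 : (0 : ℝ) < r := by exact_mod_cast hr
  have hn0 : (0 : ℝ) < n := n.cast_nonneg.lt_of_ne fun h => by
    rw [← h, mul_zero] at hrn
    linarith
  have hr2n : 2 * (r : ℝ) ≤ n := hrn.trans (mul_le_of_le_one_left hn0.le (by linarith))
  have htriangle := log_triangleCount_le_log_V hr (by exact_mod_cast hr2n : 2 * r ≤ n)
  obtain ⟨p, hp⟩ : ∃ p : ℝ, p = r / n := ⟨_, rfl⟩
  have hp0 : 0 < p := hp ▸ div_pos hr0 hn0
  have hpn : r = p * n := by rw [hp, div_mul_cancel₀ _ hn0.ne']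
  have hup : u ≤ 1 - 2 * p := by
    rw [hpn, ← mul_assoc] at hrn
    linarith [le_of_mul_le_mul_right hrn hn0]
  rw [← hp] at htriangle
  have hgap : r / 2 * (u ^ 2 / 4 * logOdds p) ≤ r / 2 * (logOdds p - 2 * (1 - 2 * p)) :=
    mul_le_mul_of_nonneg_left (sq_mul_logOdds_le hp0 hu.le hup) (by positivity)
  have hV : u ^ 2 / 16 * (u / 2 * log (V n r)) ≤ u ^ 2 / 16 * (r * logOdds p) := by
    refine mul_le_mul_of_nonneg_left ?_ (by positivity)
    rw [hpn, mul_comm p, mul_assoc]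
    exact half_mul_log_V_le hp0 hu.le hup hpn.le
  have hlinear : u ^ 2 / 16 * (r * (2 * u)) ≤ u ^ 2 / 16 * (r * logOdds p) := by
    gcongr
    exact two_mul_le_logOdds hp0 hu.le hup
  have hlog := log_le_mul_add_inv (by positivity : 0 < u ^ 3 / 8) hr0
  rw [inv_div] at hlog
  linarith

theorem two_pow_mul_log_V_le {u : ℝ} (hu : 0 < u) (hrn : 2 * r ≤ (1 - u) * n) :
    u ^ 3 / 64 * (2 ^ n * log (V n r)) ≤ (9 + 4 / u ^ 3) * (V n r * A₂ n (r + 1)) := by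
  rcases r.eq_zero_or_pos with rfl | hr
  · simp only [V, zero_add, Finset.sum_range_one, Nat.choose_zero_right, Nat.cast_one, log_one,
      mul_zero]
    positivity
  have hgv : (2 : ℝ) ^ n ≤ V n r * A₂ n (r + 1) := by exact_mod_cast gilbert_varshamov n r
  have hindep := two_pow_mul_log_le n r
  have hV : (V n r : ℝ) ≠ 0 := by exact_mod_cast (V_pos n r).ne'
  have hT : (0 : ℝ) < triangleCount n r := by exact_mod_cast triangleCount_pos n r
  rw [log_div hV (sqrt_ne_zero'.2 hT), log_sqrt hT.le] at hindep
  have hgain : u ^ 3 / 64 * log (V n r) - (4 / u ^ 3 + 1) ≤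
      log (V n r) - log (triangleCount n r) / 2 := by
    have := log_triangleCount_le hu hr hrn
    rw [show 8 / u ^ 3 = 2 * (4 / u ^ 3) by ring] at this
    linarith
  calc u ^ 3 / 64 * (2 ^ n * log (V n r))
      = 2 ^ n * (u ^ 3 / 64 * log (V n r) - (4 / u ^ 3 + 1)) + (4 / u ^ 3 + 1) * 2 ^ n := by ring
    _ ≤ 8 * V n r * A₂ n (r + 1) + (4 / u ^ 3 + 1) * (V n r * A₂ n (r + 1)) := by
        gcongr ?_ + _ * ?_
        exact (mul_le_mul_of_nonneg_left hgain (by positivity)).trans hindep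
    _ = (9 + 4 / u ^ 3) * (V n r * A₂ n (r + 1)) := by ring

end LogBounds

end BinaryCode

theorem mainTheorem1_general {δ : ℝ} (hδ : δ < 1 / 2) :
    ∃ c : ℝ, 0 < c ∧
      ∀ n d : ℕ, 0 < n → 0 < d → (d : ℝ) / (n : ℝ) ≤ δ →
        (BinaryCode.A₂ n d : ℝ) ≥
          c * ((2 : ℝ) ^ n / (BinaryCode.V n (d - 1) : ℝ)) *
            Real.logb 2 (BinaryCode.V n (d - 1) : ℝ) := by
  obtain ⟨u, hu⟩ : ∃ u, u = 1 - 2 * δ := ⟨_, rfl⟩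
  have hu0 : 0 < u := by linarith
  refine ⟨u ^ 3 / 64 * Real.log 2 / (9 + 4 / u ^ 3), by positivity, fun n d hn hd hdn => ?_⟩
  obtain ⟨r, rfl⟩ := Nat.exists_eq_succ_of_ne_zero hd.ne'
  rw [Nat.succ_eq_add_one, Nat.add_sub_cancel]
  have hrn : 2 * r ≤ (1 - u) * n := by
    rw [div_le_iff₀ (by exact_mod_cast hn)] at hdn
    push_cast at hdn
    rw [hu]
    linarith
  have hV : (0 : ℝ) < BinaryCode.V n r := by exact_mod_cast BinaryCode.V_pos n r
  calc _ = u ^ 3 / 64 * (2 ^ n * Real.log (BinaryCode.V n r)) /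
        ((9 + 4 / u ^ 3) * BinaryCode.V n r) := by
        rw [Real.logb]
        field_simp
    _ ≤ BinaryCode.A₂ n (r + 1) := by
        rw [div_le_iff₀ (by positivity)]
        linarith [BinaryCode.two_pow_mul_log_V_le hu0 hrn]

theorem mainTheorem1 :
    ∃ c : ℝ, 0 < c ∧
      ∀ n d : ℕ, 0 < n → 0 < d → (d : ℝ) / (n : ℝ) ≤ 0.499 →
        (BinaryCode.A₂ n d : ℝ) ≥
          c * ((2 : ℝ) ^ n / (BinaryCode.V n (d - 1) : ℝ)) *
            Real.logb 2 (BinaryCode.V n (d - 1) : ℝ) :=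
  mainTheorem1_general (by norm_num)
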